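/- A forcing notion is a preordered set $(\mathbb P,\le)$, where $p\le q$ means that $q$ is the stronger condition; $p,q$ are compatible if they have a common upper bound. $\mathbb P$ is atomless if every condition has two incompatible extensions; it is $\sigma$-linked if it is a countable union of sets in each of which any two members are compatible in $\mathbb P$; it is $\sigma$-centered if it is a countable union of sets in each of which any finitely many (at least one) members have a common upper bound in $\mathbb P$. For a cardinal $\kappa$, $\mathbf{MA}_\kappa(\sigma\text{-centered})$ says: for every $\sigma$-centered forcing notion $\mathbb Q$, all maximal antichains $\mathcal A_\alpha\subseteq\mathbb Q$ ($\alpha<\kappa$) and every $p\in\mathbb Q$ there is a filter $G\subseteq\mathbb Q$ with $p\in G$ and $G\cap\mathcal A_\alpha\ne\emptyset$ for all $\alpha<\kappa$. $\mathbb P$ adds a Cohen real if there is a $\mathbb P$-name $\dot c$ such that $\Vdash_{\mathbb P}$ "$\dot c\in 2^\omega$ and $\dot c$ belongs to no closed nowhere dense subset of $2^\omega$ coded in the ground model". **Theorem.** Let $\kappa$ be a cardinal and assume $\mathbf{MA}_\kappa(\sigma\text{-centered})$. Then every $\sigma$-linked atomless forcing notion $\mathbb P$ of size $\kappa$ adds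 a Cohen real. -/

import Mathlib

/-! Forcing notions are preorders `P`; the greater condition is the stronger one. -/

universe u v

namespace Forcing

section Conditions

variable {P : Type u} [Preorder P]

/-- Two conditions are compatible if they have a common extension. -/
def Compat (p q : P) : Prop := ∃ r, p ≤ r ∧ q ≤ r

/-- `A` is a maximal antichain: a maximal set of pairwise incompatible conditions. -/
def IsMaxAntichain (A : Set P) : Prop :=
  Maximal (fun B : Set P => B.Pairwise fun p q => ¬ Compat p q) A

/-- A set of conditions is linked if any two of its members are compatible. -/
def IsLinked (D : Set P) : Prop := ∀ p ∈ D, ∀ q ∈ D, Compat p q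

/-- A set of conditions is centered if any finitely many of its members have a common
extension (in `P`). -/
def IsCentered (D : Set P) : Prop :=
  ∀ F : Finset P, F.Nonempty → (F : Set P) ⊆ D → ∃ r : P, ∀ p ∈ F, p ≤ r

end Conditions

/-- `P` is a countable union of linked sets. -/
def IsSigmaLinked (P : Type u) [Preorder P] : Prop :=
  ∃ D : ℕ → Set P, (⋃ n, D n) = Set.univ ∧ ∀ n, IsLinked (D n)

/-- `P` is a countable union of centered sets. -/
def IsSigmaCentered (P : Type u) [Preorder P] : Prop :=
  ∃ D : ℕ → Set P, (⋃ n, D n) = Set.univ ∧ ∀ n, IsCentered (D n)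

/-- Every condition has two incompatible extensions. -/
def IsAtomless (P : Type u) [Preorder P] : Prop :=
  ∀ p : P, ∃ q r : P, p ≤ q ∧ p ≤ r ∧ ¬ Compat q r

/-- `MA_κ(Q)`: for every family of `κ` maximal antichains of `Q` and every `p : Q` there is a
filter containing `p` and meeting all of them. As stronger conditions are greater, the filters
of the forcing notion (nonempty, directed, closed under weaker conditions) are the order
ideals `Order.Ideal Q`. -/
def MartinAxiom (κ : Cardinal.{u}) (Q : Type u) [Preorder Q] : Prop :=
  ∀ (ι : Type u), Cardinal.mk ι = κ → ∀ A : ι → Set Q, (∀ i, IsMaxAntichain (A i)) → ∀ p : Q,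
    ∃ G : Order.Ideal Q, p ∈ G ∧ ∀ i, ((G : Set Q) ∩ A i).Nonempty

/-- `MA_κ(σ-centered)`: `MA_κ(Q)` holds for every `σ`-centered forcing notion `Q`. -/
def MartinAxiomSigmaCentered (κ : Cardinal.{u}) : Prop :=
  ∀ (Q : Type u) [Preorder Q], IsSigmaCentered Q → MartinAxiom κ Q

/-! ### The forcing relation

A statement of the forcing language is represented by the set of the conditions that force it.
The clauses below are the usual inductive clauses of the forcing relation; all quantifiers that
are needed range over objects of the ground model. -/

section ForcingRelation

variable {P : Type u} [Preorder P] {X : Type v}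

/-- `p ⊩ ¬ φ`: no extension of `p` forces `φ`. -/
def ForcesNot (φ : P → Prop) (p : P) : Prop := ∀ q, p ≤ q → ¬ φ q

/-- `p ⊩ φ ∧ ψ`. -/
def ForcesAnd (φ ψ : P → Prop) (p : P) : Prop := φ p ∧ ψ p

/-- `p ⊩ ∀ i ∈ ι, φ i`, for a ground model set `ι`. -/
def ForcesAll {ι : Sort*} (φ : ι → P → Prop) (p : P) : Prop := ∀ i, φ i p

/-- `p ⊩ ∃ i ∈ ι, φ i`, for a ground model set `ι`: the conditions which force `φ i` for
some `i` are dense above `p`. -/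
def ForcesEx {ι : Sort*} (φ : ι → P → Prop) (p : P) : Prop :=
  ∀ q, p ≤ q → ∃ r, q ≤ r ∧ ∃ i, φ i r

/-- A `P`-name for a subset of the ground model set `X`. Its interpretation by a generic
filter `Γ` is `{x | ∃ p ∈ Γ, (x, p) ∈ c}`. -/
abbrev Name (P : Type u) (X : Type v) : Type (max u v) := Set (X × P)

/-- `p ⊩ x ∈ c`: the conditions extending some `q` with `(x, q) ∈ c` are dense above `p`. -/
def ForcesMem (x : X) (c : Name P X) (p : P) : Prop :=
  ∀ q, p ≤ q → ∃ r, q ≤ r ∧ ∃ s, (x, s) ∈ c ∧ s ≤ r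

/-- `p ⊩ c ∈ 2^ω`, i.e. `p` forces that the relation `c ⊆ ω × 2` is a function from `ω` to `2`:
it is total, and never contains both `(n, 0)` and `(n, 1)`. -/
def ForcesIsReal (c : Name P (ℕ × Bool)) : P → Prop :=
  ForcesAnd
    (ForcesAll fun n : ℕ => ForcesEx fun b : Bool => ForcesMem (n, b) c)
    (ForcesAll fun n : ℕ => ForcesNot
      (ForcesAnd (ForcesMem (n, false) c) (ForcesMem (n, true) c)))

/-- `p ⊩ c ∈ A*`, where `A ⊆ 2^ω` is a closed set of the ground model and `A*` is the closed set
of the extension with the same code, that is, the set of all branches of the tree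
`{x ↾ n | x ∈ A, n ∈ ω}`: for every `n` there is `x ∈ A` with `c ↾ n = x ↾ n`. -/
def ForcesMemClosed (c : Name P (ℕ × Bool)) (A : Set (ℕ → Bool)) : P → Prop :=
  ForcesAll fun n : ℕ => ForcesEx fun x : A => ForcesAll fun i : Fin n =>
    ForcesMem ((i : ℕ), x.1 i) c

/-- `p ⊩ c is a Cohen real over V`: `c ∈ 2^ω` and `c` avoids every closed nowhere dense set
coded in the ground model. -/
def ForcesIsCohen (c : Name P (ℕ × Bool)) : P → Prop :=
  ForcesAnd (ForcesIsReal c)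
    (ForcesAll fun A : {A : Set (ℕ → Bool) // IsClosed A ∧ IsNowhereDense A} =>
      ForcesNot (ForcesMemClosed c A.1))

end ForcingRelation

/-- `P` adds a Cohen real: there is a `P`-name `c` such that every condition forces that
`c` is a Cohen real over the ground model. -/
def AddsCohenReal (P : Type u) [Preorder P] : Prop :=
  ∃ c : Name P (ℕ × Bool), ∀ p : P, ForcesIsCohen c p

end Forcing

namespace Forcing

/-! ### Maximal antichains and dense sets. -/

section Antichains

variable {P : Type u} [Preorder P]

/-! A σ-linked atomless forcing adds a new real x in ω^ω (`exists_isNewReal`). For each condition p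
fix a ground model real z_p all of whose initial segments remain possible for x above p. Martin's
axiom for `Labelling` yields sets U_n of pairwise incomparable words labelled by binary words. The
Cohen real concatenates the labels that x meets in U_0, U_1, ...

The promises make each z_p miss some U_n. Given p, take the least n such that z_r misses U_n for
some r ≥ p. Then z_r passes through a word of every earlier U_i, so following z_r long enough fixes
the first n labels. Genericity lets x do so and still meet any prescribed label t in U_n
(`Labelling.exists_le_word`). So above p some fixed word σ can be continued arbitrarily
(`IsNewReal.addsCohenReal`), which suffices by `addsCohenReal_of_forall_exists`. -/

theorem exists_isMaxAntichain_subset {D : Set P} (hD : ∀ p, ∃ q, p ≤ q ∧ q ∈ D) :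
    ∃ A ⊆ D, IsMaxAntichain A := by
  obtain ⟨A, hA⟩ := zorn_subset {A : Set P | A ⊆ D ∧ A.Pairwise fun p q => ¬ Compat p q} (by
    intro c hc hchain
    refine ⟨⋃₀ c, ⟨Set.sUnion_subset fun s hs => (hc hs).1, ?_⟩, fun s hs => Set.subset_sUnion_of_mem hs⟩
    exact (Set.pairwise_sUnion hchain.directedOn).2 fun s hs => (hc hs).2)
  refine ⟨A, hA.prop.1, hA.prop.2, ?_⟩
  intro B hB hAB b hb
  by_contra hbA
  obtain ⟨q, hbq, hq⟩ := hD b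
  have hins : insert q A ⊆ D ∧ (insert q A).Pairwise fun p q => ¬ Compat p q := by
    refine ⟨Set.insert_subset hq hA.prop.1, ?_⟩
    refine hA.prop.2.insert fun a ha _ => ?_
    have hne : b ≠ a := fun h => hbA (h ▸ ha)
    refine ⟨fun ⟨r, h1, h2⟩ => hB hb (hAB ha) hne ⟨r, hbq.trans h1, h2⟩,
      fun ⟨r, h1, h2⟩ => hB hb (hAB ha) hne ⟨r, hbq.trans h2, h1⟩⟩
  have hqA : q ∈ A := hA.le_of_ge hins (Set.subset_insert q A) (Set.mem_insert q A)
  exact hB hb (hAB hqA) (fun h => hbA (h ▸ hqA)) ⟨q, hbq, le_rfl⟩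

theorem IsMaxAntichain.exists_compat {A : Set P} (hA : IsMaxAntichain A) (p : P) :
    ∃ a ∈ A, ∃ r, p ≤ r ∧ a ≤ r := by
  by_contra! h
  have hins : (insert p A).Pairwise fun p q => ¬ Compat p q :=
    hA.prop.insert fun a ha _ =>
      ⟨fun ⟨r, h1, h2⟩ => h a ha r h1 h2, fun ⟨r, h1, h2⟩ => h a ha r h2 h1⟩
  exact h p (hA.le_of_ge hins (Set.subset_insert p A) (Set.mem_insert p A)) p le_rfl le_rfl

theorem IsMaxAntichain.eq_of_le {A : Set P} (hA : IsMaxAntichain A) {a b r : P} (ha : a ∈ A)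
    (hb : b ∈ A) (har : a ≤ r) (hbr : b ≤ r) : a = b := by
  by_contra h
  exact hA.prop ha hb h ⟨r, har, hbr⟩

/-- Martin's axiom for at most `κ` dense sets. -/
theorem MartinAxiom.exists_ideal_meets_dense {κ : Cardinal.{u}} (h : MartinAxiom κ P)
    {ι : Type u} [Nonempty ι] (hι : Cardinal.mk ι ≤ κ) (D : ι → Set P)
    (hD : ∀ i p, ∃ q, p ≤ q ∧ q ∈ D i) (p : P) :
    ∃ G : Order.Ideal P, p ∈ G ∧ ∀ i, ∃ q ∈ G, q ∈ D i := by
  choose A hAD hA using fun i => exists_isMaxAntichain_subset (hD i)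
  rw [← Cardinal.mk_out κ] at hι
  obtain ⟨e⟩ := Cardinal.le_def _ _ |>.1 hι
  -- The axiom speaks of exactly κ antichains, so the family is reindexed with repetitions.
  obtain ⟨f, hf⟩ : ∃ f : κ.out → ι, Function.Surjective f :=
    ⟨Function.invFun e, Function.invFun_surjective e.injective⟩
  obtain ⟨G, hpG, hG⟩ := h κ.out (Cardinal.mk_out κ) (fun i => A (f i)) (fun i => hA _) p
  refine ⟨G, hpG, fun i => ?_⟩
  obtain ⟨j, rfl⟩ := hf i
  obtain ⟨q, hq, hqA⟩ := hG j
  exact ⟨q, hq, hAD _ hqA⟩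

theorem IsAtomless.noMaxOrder (h : IsAtomless P) : NoMaxOrder P where
  exists_gt p := by
    obtain ⟨q, r, hq, hr, hqr⟩ := h p
    exact ⟨q, lt_of_le_not_ge hq fun hqp => hqr ⟨r, hqp.trans hr, le_rfl⟩⟩

end Antichains

/-! ### The new real and its initial segments. -/

/-- A name for a new element `x` of `ω^ω`: `dec p m j` says that `p` decides `x m = j`. -/
structure IsNewReal {P : Type u} [Preorder P] (dec : P → ℕ → ℕ → Prop) : Prop where
  mono : ∀ {p q m j}, p ≤ q → dec p m j → dec q m j
  unique : ∀ {p m j j'}, dec p m j → dec p m j' → j = j'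
  total : ∀ p m, ∃ q, p ≤ q ∧ ∃ j, dec q m j
  split : ∀ p, ∃ m j j' q q', p ≤ q ∧ p ≤ q' ∧ dec q m j ∧ dec q' m j' ∧ j ≠ j'

/-- x(m) is the index of a linked piece containing the generic member of `A m`. A linked set meets
an antichain in at most one point, so x(m) determines that member. If p lies in `D m`, no member of
`A m` is compatible with all extensions of p, so p cannot decide x(m). -/
theorem exists_isNewReal {P : Type u} [Preorder P] (hlinked : IsSigmaLinked P)
    (hatomless : IsAtomless P) : ∃ dec : P → ℕ → ℕ → Prop, IsNewReal dec := by
  obtain ⟨D, hD, hDl⟩ := hlinked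
  have hmem : ∀ p, ∃ n, p ∈ D n := fun p => Set.mem_iUnion.1 (hD ▸ Set.mem_univ p)
  choose e he using hmem
  have hdense : ∀ m p, ∃ q, p ≤ q ∧ q ∈ {a : P | ∀ d ∈ D m, ∃ r, d ≤ r ∧ ¬ Compat r a} := by
    intro m p
    obtain ⟨q, r, hq, hr, hqr⟩ := hatomless p
    by_contra! h
    have h1 := h q hq
    have h2 := h r hr
    simp only [Set.mem_ofPred_eq, not_forall, not_exists, not_and, not_not] at h1 h2
    obtain ⟨d, hd, hdq⟩ := h1
    obtain ⟨d', hd', hdr⟩ := h2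
    -- All extensions of `d` are compatible with `q` and all those of `d'` with `r`, so linking `d`
    -- and `d'` would make `q` and `r` compatible.
    obtain ⟨w, hdw, hdw'⟩ := hDl m d hd d' hd'
    obtain ⟨w₁, hw₁, hqw₁⟩ := hdq w hdw
    obtain ⟨w₂, hw₂, hrw₂⟩ := hdr w₁ (hdw'.trans hw₁)
    exact hqr ⟨w₂, hqw₁.trans hw₂, hrw₂⟩
  choose A hAS hA using fun m => exists_isMaxAntichain_subset (hdense m)
  refine ⟨fun p m j => ∃ a ∈ A m, e a = j ∧ a ≤ p, ?_, ?_, ?_, ?_⟩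
  · rintro p q m j hpq ⟨a, ha, hj, hap⟩
    exact ⟨a, ha, hj, hap.trans hpq⟩
  · rintro p m _ _ ⟨a, ha, rfl, hap⟩ ⟨b, hb, rfl, hbp⟩
    rw [(hA m).eq_of_le ha hb hap hbp]
  · intro p m
    obtain ⟨a, ha, r, hpr, har⟩ := (hA m).exists_compat p
    exact ⟨r, hpr, e a, a, ha, rfl, har⟩
  · intro p
    obtain ⟨a, ha, q, hpq, haq⟩ := (hA (e p)).exists_compat p
    obtain ⟨r, hpr, hra⟩ := hAS _ ha p (he p)
    obtain ⟨b, hb, q', hrq', hbq'⟩ := (hA (e p)).exists_compat r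
    refine ⟨e p, e a, e b, q, q', hpq, hpr.trans hrq', ⟨a, ha, rfl, haq⟩, ⟨b, hb, rfl, hbq'⟩, ?_⟩
    intro hab
    obtain ⟨w, haw, hbw⟩ := hDl (e a) a (he a) b (hab ▸ he b)
    obtain rfl := (hA _).eq_of_le ha hb haw hbw
    exact hra ⟨q', hrq', hbq'⟩

/-- Every entry of the word `s` is as prescribed by the relation `φ`. -/
def Follows (φ : ℕ → ℕ → Prop) (s : List ℕ) : Prop := ∀ i j, s[i]? = some j → φ i j

theorem Follows.of_prefix {φ : ℕ → ℕ → Prop} {s t : List ℕ} (h : Follows φ t) (hst : s <+: t) :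
    Follows φ s := by
  obtain ⟨l, rfl⟩ := hst
  intro i j hij
  exact h i j (by rw [List.getElem?_append_left (List.getElem?_eq_some_iff.1 hij).1, hij])

theorem Follows.isPrefix {φ : ℕ → ℕ → Prop} (hφ : ∀ i j j', φ i j → φ i j' → j = j')
    {s t : List ℕ} (hs : Follows φ s) (ht : Follows φ t) (hst : s.length ≤ t.length) :
    s <+: t := by
  rw [List.prefix_iff_getElem]
  refine ⟨hst, fun i hi => hφ i _ _ (hs i _ (List.getElem?_eq_getElem hi))
    (ht i _ (List.getElem?_eq_getElem (hi.trans_le hst)))⟩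

namespace IsNewReal

variable {P : Type u} [Preorder P] {dec : P → ℕ → ℕ → Prop}

/-- The tree of the possible initial segments of `x` above `p` has a branch. -/
theorem exists_branch (h : IsNewReal dec) (p : P) :
    ∃ z : ℕ → ℕ, ∀ k, ∃ q, p ≤ q ∧ ∀ i < k, dec q i (z i) := by
  choose f hf g hg using h.total
  let q : ℕ → P := fun n => Nat.rec p (fun m r => f r m) n
  have hq : Monotone q := monotone_nat_of_le_succ fun n => hf (q n) n
  exact ⟨fun n => g (q n) n, fun k => ⟨q k, hq (Nat.zero_le k), fun i hi =>
    h.mono (hq (Nat.succ_le_of_lt hi)) (hg (q i) i)⟩⟩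

theorem exists_follows (h : IsNewReal dec) (p : P) (k : ℕ) :
    ∃ q, p ≤ q ∧ ∃ s : List ℕ, s.length = k ∧ Follows (dec q) s := by
  obtain ⟨z, hz⟩ := h.exists_branch p
  obtain ⟨q, hpq, hq⟩ := hz k
  refine ⟨q, hpq, (List.range k).map z, by simp, fun i j hij => ?_⟩
  simp only [List.getElem?_map, Option.map_eq_some_iff] at hij
  obtain ⟨a, ha, rfl⟩ := hij
  obtain ⟨hi, rfl⟩ := List.getElem?_eq_some_iff.1 ha
  simpa using hq i (by simpa using hi)

theorem exists_ne (h : IsNewReal dec) (p : P) (z : ℕ → ℕ) :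
    ∃ q, p ≤ q ∧ ∃ m j, dec q m j ∧ z m ≠ j := by
  obtain ⟨m, j, j', q, q', hq, hq', hj, hj', hne⟩ := h.split p
  by_cases hz : z m = j
  · exact ⟨q', hq', m, j', hj', hz ▸ hne⟩
  · exact ⟨q, hq, m, j, hj, hz⟩

/-- Above any condition, `x` can be moved away from finitely many ground model reals. -/
theorem exists_follows_avoiding (h : IsNewReal dec) {Z : Set (ℕ → ℕ)} (hZ : Z.Finite) (p : P)
    (k : ℕ) : ∃ q, p ≤ q ∧ ∃ s : List ℕ, k ≤ s.length ∧ Follows (dec q) s ∧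
      ∀ z ∈ Z, ¬ Follows (fun i j => z i = j) s := by
  have key : ∃ q, p ≤ q ∧ ∃ M, ∀ z ∈ Z, ∃ m < M, ∃ j, dec q m j ∧ z m ≠ j := by
    induction Z, hZ using Set.Finite.induction_on with
    | empty => exact ⟨p, le_rfl, 0, by simp⟩
    | @insert z Z _ _ ih =>
      obtain ⟨q, hpq, M, hM⟩ := ih
      obtain ⟨r, hqr, m, j, hj, hne⟩ := h.exists_ne q z
      refine ⟨r, hpq.trans hqr, max M (m + 1), fun z' hz' => ?_⟩
      rcases hz' with rfl | hz'
      · exact ⟨m, by omega, j, hj, hne⟩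
      · obtain ⟨m', hm', j', hj', hne'⟩ := hM z' hz'
        exact ⟨m', by omega, j', h.mono hqr hj', hne'⟩
  obtain ⟨q, hpq, M, hM⟩ := key
  obtain ⟨r, hqr, s, hs, hrs⟩ := h.exists_follows q (max k M)
  refine ⟨r, hpq.trans hqr, s, by omega, hrs, fun z hz hzs => ?_⟩
  obtain ⟨m, hm, j, hj, hne⟩ := hM z hz
  have hms : s[m]? = some s[m] := List.getElem?_eq_getElem (by omega)
  exact hne ((hzs m _ hms).trans (h.unique (hrs m _ hms) (h.mono hqr hj)))

end IsNewReal

/-! ### The σ-centered forcing of labelled words. -/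

/-- Conditions consist of finitely many labelled words for each `n`, no two of which are
comparable, and finitely many promises `(n, p)` that no `n`-th word will ever be an initial
segment of the real `z p`. -/
structure Labelling (P : Type u) (z : P → ℕ → ℕ) : Type u where
  words : Finset (ℕ × List ℕ × List Bool)
  promises : Set (ℕ × P)
  finite_promises : promises.Finite
  avoids : ∀ n s t p, (n, s, t) ∈ words → (n, p) ∈ promises → ¬ Follows (fun i j => z p i = j) s
  prefixFree : ∀ n s t s' t', (n, s, t) ∈ words → (n, s', t') ∈ words → s <+: s' →
    s = s' ∧ t = t'

namespace Labelling

variable {P : Type u} {z : P → ℕ → ℕ}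

instance : Preorder (Labelling P z) where
  le g g' := g.words ⊆ g'.words ∧ g.promises ⊆ g'.promises
  le_refl g := ⟨subset_rfl, subset_rfl⟩
  le_trans _ _ _ h h' := ⟨h.1.trans h'.1, h.2.trans h'.2⟩

instance : Inhabited (Labelling P z) :=
  ⟨⟨∅, ∅, Set.finite_empty, by simp, by simp⟩⟩

/-- Conditions with the same words are amalgamated by uniting their promises, and there are only
countably many finite sets of words. -/
theorem isSigmaCentered : IsSigmaCentered (Labelling P z) := by
  refine ⟨fun n => {g | Encodable.encode g.words = n}, by ext; simp, fun n F hne hF => ?_⟩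
  obtain ⟨g₀, hg₀⟩ := hne
  have hw : ∀ g ∈ F, g.words = g₀.words := fun g hg =>
    Encodable.encode_injective ((hF hg).trans (hF hg₀).symm)
  refine ⟨⟨g₀.words, ⋃ g ∈ F, g.promises, F.finite_toSet.biUnion fun g _ => g.finite_promises, ?_,
    g₀.prefixFree⟩, fun g hg => ⟨(hw g hg).subset, Set.subset_biUnion_of_mem hg⟩⟩
  intro n s t p hs hp
  obtain ⟨g, hg, hgp⟩ := Set.mem_iUnion₂.1 hp
  exact g.avoids n s t p (hw g hg ▸ hs) hgp

theorem exists_le_promise (g : Labelling P z) (p : P) :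
    ∃ g', g ≤ g' ∧ ∃ n, (n, p) ∈ g'.promises := by
  -- At an index without words the new promise holds vacuously.
  obtain ⟨n, hn⟩ := Infinite.exists_notMem_finset (g.words.image Prod.fst)
  refine ⟨⟨g.words, insert (n, p) g.promises, g.finite_promises.insert _, ?_, g.prefixFree⟩,
    ⟨subset_rfl, Set.subset_insert _ _⟩, n, Set.mem_insert _ _⟩
  rintro m s t q hs (hq | hq)
  · obtain ⟨rfl, rfl⟩ := Prod.mk.inj hq
    exact absurd (Finset.mem_image_of_mem Prod.fst hs) hn
  · exact g.avoids m s t q hs hq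

/-- Unless an n-th word already lies on `z p`, x can follow `z p` beyond all existing words and then
leave every promised real; the word read there is added with label `t`. -/
theorem exists_le_word [Preorder P] {dec : P → ℕ → ℕ → Prop} (h : IsNewReal dec)
    (hz : ∀ p k, ∃ q, p ≤ q ∧ ∀ i < k, dec q i (z p i))
    (g : Labelling P z) (p : P) (n : ℕ) (t : List Bool) (k : ℕ) :
    ∃ g', g ≤ g' ∧ ((∃ s t', (n, s, t') ∈ g'.words ∧ Follows (fun i j => z p i = j) s) ∨
      ∃ s, (n, s, t) ∈ g'.words ∧ ∃ q, p ≤ q ∧ (∀ i < k, dec q i (z p i)) ∧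
        Follows (dec q) s) := by
  by_cases hcut : ∃ s t', (n, s, t') ∈ g.words ∧ Follows (fun i j => z p i = j) s
  · exact ⟨g, le_rfl, Or.inl hcut⟩
  -- A word of length at least `K` is no prefix of an old word, and an old n-th word below it would
  -- lie on `z p`.
  set K := max k (g.words.sup fun w => w.2.1.length + 1)
  have hK : ∀ w ∈ g.words, w.2.1.length < K := fun w hw =>
    (Finset.le_sup (f := fun w : ℕ × List ℕ × List Bool => w.2.1.length + 1) hw).trans
      (le_max_right k _)
  obtain ⟨q, hpq, hq⟩ := hz p K
  obtain ⟨r, hqr, s, hs, hrs, hav⟩ :=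
    h.exists_follows_avoiding ((g.finite_promises.image Prod.snd).image z) q K
  have hnot : ∀ s' t', (n, s', t') ∈ g.words → ¬ s' <+: s := by
    intro s' t' hs' hpre
    refine hcut ⟨s', t', hs', fun i j hij => ?_⟩
    have hi := (List.getElem?_eq_some_iff.1 hij).1.trans (hK _ hs')
    exact h.unique (h.mono hqr (hq i hi)) (hrs.of_prefix hpre i j hij)
  have hnot' : ∀ s' t', (n, s', t') ∈ g.words → ¬ s <+: s' := fun s' t' hs' hpre =>
    absurd (hK _ hs') (not_lt.2 (hs.trans hpre.length_le))
  refine ⟨⟨insert (n, s, t) g.words, g.promises, g.finite_promises, ?_, ?_⟩,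
    ⟨Finset.subset_insert _ _, subset_rfl⟩, Or.inr ⟨s, Finset.mem_insert_self _ _, r,
      hpq.trans hqr, fun i hi => h.mono hqr (hq i (hi.trans_le (le_max_left _ _))), hrs⟩⟩
  · intro m s' t' p' hs' hp'
    rcases Finset.mem_insert.1 hs' with heq | hs'
    · simp only [Prod.mk.injEq] at heq
      obtain ⟨rfl, rfl, rfl⟩ := heq
      exact hav _ ⟨p', ⟨_, hp', rfl⟩, rfl⟩
    · exact g.avoids m s' t' p' hs' hp'
  · intro m s₁ t₁ s₂ t₂ h₁ h₂ hpre
    rcases Finset.mem_insert.1 h₁ with k₁ | k₁ <;> rcases Finset.mem_insert.1 h₂ with k₂ | k₂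
    · simp_all
    · simp only [Prod.mk.injEq] at k₁
      obtain ⟨rfl, rfl, rfl⟩ := k₁
      exact absurd hpre (hnot' _ _ k₂)
    · simp only [Prod.mk.injEq] at k₂
      obtain ⟨rfl, rfl, rfl⟩ := k₂
      exact absurd hpre (hnot _ _ k₁)
    · exact g.prefixFree m s₁ t₁ s₂ t₂ k₁ k₂ hpre

end Labelling

/-! ### From generic labelled words to a Cohen real. -/

section Cohen

variable {P : Type u} [Preorder P]

theorem exists_append_notMem {A : Set (ℕ → Bool)} (hA : IsClosed A) (hnd : IsNowhereDense A)
    (σ : List Bool) : ∃ t : List Bool, ∀ x ∈ A, ∃ i b, (σ ++ t)[i]? = some b ∧ x i ≠ b := by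
  have hint : interior A = ∅ := by rwa [IsNowhereDense, hA.closure_eq] at hnd
  let y : ℕ → Bool := fun i => σ.getD i false
  obtain ⟨x, hxy, hxA⟩ : ∃ x ∈ PiNat.cylinder y σ.length, x ∉ A := by
    by_contra! hsub
    have : y ∈ interior A := interior_maximal hsub (PiNat.isOpen_cylinder _ y _)
      (PiNat.self_mem_cylinder y _)
    simp [hint] at this
  obtain ⟨_, ⟨x', k, rfl⟩, hxk, hkA⟩ :=
    (PiNat.isTopologicalBasis_cylinders fun _ : ℕ => Bool).exists_subset_of_mem_open
      (show x ∈ Aᶜ from hxA) hA.isOpen_compl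
  rw [PiNat.mem_cylinder_iff] at hxy hxk
  have hpre : σ <+: (List.range (max σ.length k)).map x := by
    rw [List.prefix_iff_getElem]
    refine ⟨by simp, fun i hi => ?_⟩
    simp [hxy i hi, y, hi]
  obtain ⟨t, ht⟩ := hpre
  refine ⟨t, fun a ha => ?_⟩
  by_contra! hall
  refine hkA (PiNat.mem_cylinder_iff.2 fun i hi => ?_) ha
  rw [hall i (x i) (by rw [ht]; simp [hi]), hxk i hi]

/-- A criterion for adding a Cohen real, where `R p w` says that `p` forces the word `w` to be an
initial segment of the real. -/
theorem addsCohenReal_of_forall_exists (R : P → List Bool → Prop)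
    (hmono : ∀ {p q w}, p ≤ q → R p w → R q w)
    (hcomp : ∀ {p w w'}, R p w → R p w' → w <+: w' ∨ w' <+: w)
    (hR : ∀ p, ∃ σ, ∀ t, ∃ q, p ≤ q ∧ R q (σ ++ t)) : AddsCohenReal P := by
  have huniq : ∀ {p w w'} {i : ℕ} {b b' : Bool}, R p w → R p w' → w[i]? = some b → w'[i]? = some b' →
      b = b' := by
    have aux : ∀ {w w' : List Bool} {i : ℕ} {b b' : Bool}, w <+: w' → w[i]? = some b → w'[i]? = some b' →
        b = b' := by
      rintro w _ i b b' ⟨l, rfl⟩ hb hb'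
      rw [List.getElem?_append_left (List.getElem?_eq_some_iff.1 hb).1, hb] at hb'
      exact Option.some.inj hb'
    intro p w w' i b b' h h' hb hb'
    rcases hcomp h h' with hw | hw
    · exact aux hw hb hb'
    · exact (aux hw hb' hb).symm
  let c : Name P (ℕ × Bool) := {x | ∃ w, R x.2 w ∧ w[x.1.1]? = some x.1.2}
  have hmem : ∀ {p w} {i : ℕ} {b : Bool}, R p w → w[i]? = some b → ForcesMem (i, b) c p :=
    fun {p w i b} hw hb q hpq => ⟨q, le_rfl, q, ⟨w, hmono hpq hw, hb⟩, le_rfl⟩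
  have hex : ∀ {p i b}, ForcesMem (i, b) c p → ∃ q, p ≤ q ∧ ∃ w, R q w ∧ w[i]? = some b := by
    intro p i b h
    obtain ⟨r, hr, s, ⟨w, hw, hb⟩, hs⟩ := h p le_rfl
    exact ⟨r, hr, w, hmono hs hw, hb⟩
  refine ⟨c, fun p => ⟨⟨fun n q _ => ?_, fun n q _ hq => ?_⟩, fun A q _ hq => ?_⟩⟩
  · obtain ⟨σ, hσ⟩ := hR q
    obtain ⟨r, hqr, hr⟩ := hσ (List.replicate (n + 1) false)
    have hn : n < (σ ++ List.replicate (n + 1) false).length := by simp; omega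
    exact ⟨r, hqr, _, hmem hr (List.getElem?_eq_getElem hn)⟩
  · obtain ⟨r, hqr, w, hw, hb⟩ := hex hq.1
    obtain ⟨r', hrr', w', hw', hb'⟩ :=
      hex (p := r) (i := n) (b := true) fun s hs => hq.2 s (hqr.trans hs)
    exact Bool.false_ne_true (huniq (hmono hrr' hw) hw' hb hb')
  · obtain ⟨σ, hσ⟩ := hR q
    -- No point of `A` extends `σ ++ t`, so forcing this word takes the real out of `A`.
    obtain ⟨t, ht⟩ := exists_append_notMem A.2.1 A.2.2 σ
    obtain ⟨r, hqr, hr⟩ := hσ t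
    obtain ⟨r', hrr', x, hx⟩ := hq (σ ++ t).length r hqr
    obtain ⟨i, b, hi, hne⟩ := ht x.1 x.2
    obtain ⟨r'', hr'', w, hw, hb⟩ := hex (hx ⟨i, (List.getElem?_eq_some_iff.1 hi).1⟩)
    exact hne (huniq hw (hmono (hrr'.trans hr'') hr) hb hi)

/-- If the labelled words `U` are generic enough, then concatenating the labels of the initial
segments of the new real gives a Cohen real. -/
theorem IsNewReal.addsCohenReal {dec : P → ℕ → ℕ → Prop} (h : IsNewReal dec) {z : P → ℕ → ℕ}
    (U : Set (ℕ × List ℕ × List Bool))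
    (hU : ∀ n s t s' t', (n, s, t) ∈ U → (n, s', t') ∈ U → s <+: s' → s = s' ∧ t = t')
    (hz : ∀ p, ∃ n, ∀ s t, (n, s, t) ∈ U → ¬ Follows (fun i j => z p i = j) s)
    (hlabel : ∀ p n t k, (∃ s t', (n, s, t') ∈ U ∧ Follows (fun i j => z p i = j) s) ∨
      ∃ s, (n, s, t) ∈ U ∧ ∃ q, p ≤ q ∧ (∀ i < k, dec q i (z p i)) ∧ Follows (dec q) s) :
    AddsCohenReal P := by
  have hUeq : ∀ {p n s t s' t'}, (n, s, t) ∈ U → (n, s', t') ∈ U → Follows (dec p) s →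
      Follows (dec p) s' → t = t' := by
    intro p n s t s' t' hs hs' hps hps'
    rcases le_total s.length s'.length with hle | hle
    · exact (hU n s t s' t' hs hs' (Follows.isPrefix (φ := dec p) (fun _ _ _ => h.unique) hps hps' hle)).2
    · exact (hU n s' t' s t hs' hs (Follows.isPrefix (φ := dec p) (fun _ _ _ => h.unique) hps' hps hle)).2.symm
  refine addsCohenReal_of_forall_exists
    (fun p w => ∃ (n : ℕ) (f : ℕ → List Bool),
      (∀ i < n, ∃ s, (i, s, f i) ∈ U ∧ Follows (dec p) s) ∧ w <+: ((List.range n).map f).flatten)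
    ?_ ?_ ?_
  · rintro p q w hpq ⟨n, f, hf, hw⟩
    refine ⟨n, f, fun i hi => ?_, hw⟩
    obtain ⟨s, hs, hps⟩ := hf i hi
    exact ⟨s, hs, fun i j hij => h.mono hpq (hps i j hij)⟩
  · rintro p w w' ⟨n, f, hf, hw⟩ ⟨n', f', hf', hw'⟩
    wlog hle : n ≤ n' generalizing n n' f f' w w'
    · exact (this n' f' hf' hw' n f hf hw (by omega)).symm
    have heq : (List.range n).map f = (List.range n).map f' := by
      refine List.map_congr_left fun i hi => ?_
      have hi := List.mem_range.1 hi
      obtain ⟨s, hs, hps⟩ := hf i hi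
      obtain ⟨s', hs', hps'⟩ := hf' i (by omega)
      exact hUeq hs hs' hps hps'
    have hpre : ((List.range n).map f).flatten <+: ((List.range n').map f').flatten := by
      obtain ⟨m, rfl⟩ := Nat.exists_eq_add_of_le hle
      rw [heq, List.range_add, List.map_append, List.flatten_append]
      exact List.prefix_append _ _
    exact List.prefix_or_prefix_of_prefix (hw.trans hpre) hw'
  · intro p
    classical
    have hex : ∃ n, ∃ r, p ≤ r ∧ ∀ s t, (n, s, t) ∈ U → ¬ Follows (fun i j => z r i = j) s :=
      (hz p).imp fun n hn => ⟨p, le_rfl, hn⟩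
    obtain ⟨r, hpr, hr⟩ := Nat.find_spec hex
    have hmin : ∀ i, ∃ s t, i < Nat.find hex → (i, s, t) ∈ U ∧ Follows (fun i j => z r i = j) s := by
      intro i
      by_cases hi : i < Nat.find hex
      · have := Nat.find_min hex hi
        push Not at this
        obtain ⟨s, t, hs⟩ := this r hpr
        exact ⟨s, t, fun _ => hs⟩
      · exact ⟨[], [], fun h => absurd h hi⟩
    set n := Nat.find hex
    choose s f hs using hmin
    refine ⟨((List.range n).map f).flatten, fun t => ?_⟩
    -- The bound covers all `s i` with `i < n`, so a condition agreeing with `z r` that far keeps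
    -- the first n labels.
    obtain ⟨s₀, t', hs₀, hz₀⟩ | ⟨s₀, hs₀, q, hrq, hq, hqs₀⟩ :=
      hlabel r n t ((Finset.range n).sup fun i => (s i).length)
    · exact absurd hz₀ (hr s₀ t' hs₀)
    refine ⟨q, hpr.trans hrq, n + 1, fun i => if i = n then t else f i, fun i hi => ?_, ?_⟩
    · by_cases hin : i = n
      · subst hin
        exact ⟨s₀, by simpa using hs₀, hqs₀⟩
      · have hi : i < n := by omega
        refine ⟨s i, by simpa [hin] using (hs i hi).1, fun m j hmj => ?_⟩
        rw [← (hs i hi).2 m j hmj]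
        exact hq m ((List.getElem?_eq_some_iff.1 hmj).1.trans_le
          (Finset.le_sup (f := fun i => (s i).length) (Finset.mem_range.2 hi)))
    · have heq : (List.range n).map (fun i => if i = n then t else f i) = (List.range n).map f :=
        List.map_congr_left fun i hi => if_neg (List.mem_range.1 hi).ne
      rw [List.range_succ, List.map_append, List.flatten_append, heq]
      simp

end Cohen

end Forcing

theorem mainTheorem3 (κ : Cardinal.{u}) (hMA : Forcing.MartinAxiomSigmaCentered κ)
    (P : Type u) [Preorder P] (hlinked : Forcing.IsSigmaLinked P)
    (hatomless : Forcing.IsAtomless P) (hcard : Cardinal.mk P = κ) :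
    Forcing.AddsCohenReal P := by
  open Forcing in
  rcases isEmpty_or_nonempty P with hP | hP
  · exact ⟨∅, fun p => hP.elim p⟩
  have := hatomless.noMaxOrder
  have hinf : Infinite P := NoMaxOrder.infinite
  obtain ⟨dec, h⟩ := exists_isNewReal hlinked hatomless
  choose z hz using h.exists_branch
  -- Countably many dense sets per condition make at most κ, as atomlessness makes `P` infinite.
  have hι : Cardinal.mk (P × Option (ℕ × List Bool × ℕ)) ≤ κ := by
    rw [Cardinal.mk_prod, Cardinal.mk_eq_aleph0 (Option (ℕ × List Bool × ℕ)), hcard]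
    have : Cardinal.aleph0 ≤ κ := hcard ▸ Cardinal.aleph0_le_mk P
    simpa using (Cardinal.mul_aleph0_eq this).le
  obtain ⟨G, -, hG⟩ := (hMA (Labelling P z) Labelling.isSigmaCentered).exists_ideal_meets_dense hι
    (fun i => match i with
      | (p, none) => {g | ∃ n, (n, p) ∈ g.promises}
      | (p, some (n, t, k)) => {g |
        (∃ s t', (n, s, t') ∈ g.words ∧ Follows (fun i j => z p i = j) s) ∨
          ∃ s, (n, s, t) ∈ g.words ∧ ∃ q, p ≤ q ∧ (∀ i < k, dec q i (z p i)) ∧ Follows (dec q) s})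
    (by
      rintro ⟨p, _ | ⟨n, t, k⟩⟩ g
      · exact g.exists_le_promise p
      · exact g.exists_le_word h hz p n t k) default
  refine h.addsCohenReal (z := z) {w | ∃ g ∈ G, w ∈ g.words} ?_ ?_ ?_
  · rintro n s t s' t' ⟨g, hg, hs⟩ ⟨g', hg', hs'⟩ hpre
    obtain ⟨g'', -, hle, hle'⟩ := G.directed g hg g' hg'
    exact g''.prefixFree n s t s' t' (hle.1 hs) (hle'.1 hs') hpre
  · intro p
    obtain ⟨g, hg, n, hn⟩ := hG (p, none)
    refine ⟨n, ?_⟩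
    rintro s t ⟨g', hg', hs⟩
    obtain ⟨g'', -, hle, hle'⟩ := G.directed g hg g' hg'
    exact g''.avoids n s t p (hle'.1 hs) (hle.2 hn)
  · intro p n t k
    obtain ⟨g, hg, ⟨s, t', hs, hzs⟩ | ⟨s, hs, hq⟩⟩ := hG (p, some (n, t, k))
    · exact Or.inl ⟨s, t', ⟨g, hg, hs⟩, hzs⟩
    · exact Or.inr ⟨s, ⟨g, hg, hs⟩, hq⟩
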